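/- Let $\mathbb D$ be the open unit disk, let $q\in\mathbb C$ with $\Re q>0$, and let $r>0$. Let $F$ be holomorphic in $\mathbb D$ with $F(0)=0$, $F'(0)=1+rq$ and $\Re\frac{1}{2r\Re q}\left(\frac{F(z)}{z}-(1+rq)\right)>-\frac12$ for $z\in\mathbb D\setminus\{0\}$ (equivalently, $F(z)=z+rf(z)$ with $f(z)=zp(z)$, where $p$ is holomorphic in $\mathbb D$, $\Re p>0$ and $p(0)=q$). Let $G_r=F^{-1}=(\mathrm{Id}+rf)^{-1}:\mathbb D\to\mathbb D$ be the resolvent, that is, the self-mapping of $\mathbb D$ satisfying $F(G_r(w))=w$ for all $w\in\mathbb D$. Put $$A(x)=\frac{6x(1+x)}{(1+x)^3-3(5x-1)},$$ let $r_0$ be the largest real root of the equation $A(x)=1$, and suppose that $r\Re q>r_0$. Write $A=A(r\Re q)$. A univalent (holomorphic and injective) function $h$ in $\mathbb D$ with $h(0)=0$ is called - starlike of order $\alpha\in(0,1)$ if $\Re\frac{zh'(z)}{h(z)}>\alpha$ for all $z\in\mathbb D$; - $\theta$-spirallike of order $\alpha\in(0,1)$ if $\Re\left(e^{-i\theta}\frac{zh'(z)}{h(z)}\right)>\alpha\cos\theta$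 for all $z\in\mathbb D$; - strongly starlike of order $\beta\in(0,1)$ if $\left|\arg\frac{zh'(z)}{h(z)}\right|<\frac{\pi\beta}{2}$ for all $z\in\mathbb D$, where $zh'(z)/h(z)$ is given its limit value $1$ at $z=0$. Then: 1. for every real $\theta$ with $|\theta|\le\arccos\frac{6}{r\Re q}$ (if $r\Re q<6$, the right-hand side is read as $0$, so that only $\theta=0$ is admitted), $G_r$ is $\theta$-spirallike of order $$\frac{\cos\theta-A}{(1-A^2)\cos\theta};$$ 2. $G_r$ is starlike of order $\frac{1}{1+A}$; 3. $G_r$ is strongly starlike of order $\frac2\pi\arcsin A$. In particular, these three numbers belong to $(0,1)$. -/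

import Mathlib

noncomputable section

namespace Resolvent

/-- The open unit disk. -/
def disk : Set ℂ := Metric.ball 0 1

/-- The function `z ↦ z h'(z) / h(z)`, with its removable singularity at the origin filled in:
for a univalent `h` with `h 0 = 0` the value there is `1`. -/
def starQuotient (h : ℂ → ℂ) (z : ℂ) : ℂ :=
  if z = 0 then 1 else z * deriv h z / h z

/-- `h` is a univalent (holomorphic and injective) function in the unit disk with `h 0 = 0`. -/
structure IsUnivalentZero (h : ℂ → ℂ) : Prop where
  holo : DifferentiableOn ℂ h disk
  inj : Set.InjOn h disk
  map_zero : h 0 = 0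

/-- `h` is starlike of order `α ∈ (0, 1)`. -/
structure IsStarlikeOfOrder (α : ℝ) (h : ℂ → ℂ) : Prop where
  univalent : IsUnivalentZero h
  order_mem : α ∈ Set.Ioo (0 : ℝ) 1
  lt_re : ∀ z ∈ disk, α < (starQuotient h z).re

/-- `h` is `θ`-spirallike of order `α ∈ (0, 1)`. -/
structure IsSpirallikeOfOrder (θ α : ℝ) (h : ℂ → ℂ) : Prop where
  univalent : IsUnivalentZero h
  order_mem : α ∈ Set.Ioo (0 : ℝ) 1
  lt_re : ∀ z ∈ disk,
    α * Real.cos θ < (Complex.exp (-(Complex.I * (θ : ℂ))) * starQuotient h z).re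

/-- `h` is strongly starlike of order `β ∈ (0, 1)`. -/
structure IsStronglyStarlikeOfOrder (β : ℝ) (h : ℂ → ℂ) : Prop where
  univalent : IsUnivalentZero h
  order_mem : β ∈ Set.Ioo (0 : ℝ) 1
  abs_arg_lt : ∀ z ∈ disk, |Complex.arg (starQuotient h z)| < Real.pi * β / 2

/-- The class of functions `F` holomorphic in the unit disk with `F 0 = 0`, `F' 0 = β` and
`Re ((F z / z - β) / α) > -1/2`. At `z = 0` the quotient `F z / z` means `F' 0 = β`, so the
inequality is trivially true there and is required for `z ≠ 0` only. -/
def classA (α β : ℂ) : Set (ℂ → ℂ) :=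
  {F | DifferentiableOn ℂ F disk ∧ F 0 = 0 ∧ deriv F 0 = β ∧
    ∀ z ∈ disk, z ≠ 0 → -(1 / 2 : ℝ) < (1 / α * (F z / z - β)).re}

/-- The resolvents `G_r = (Id + r f)⁻¹`, for generators `f` with `f 0 = 0` and `f' 0 = q`: the
self-mappings `G` of the unit disk that are right inverse there to some `F = Id + r f` in the
class `classA (2 r Re q) (1 + r q)`. Such a `G` is unique given `F`; its being holomorphic is
not part of the definition. -/
def resolvents (r : ℝ) (q : ℂ) : Set (ℂ → ℂ) :=
  {G | ∃ F ∈ classA ((2 * r * q.re : ℝ) : ℂ) (1 + (r : ℂ) * q),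
    Set.MapsTo G disk disk ∧ ∀ w ∈ disk, F (G w) = w}

/-- The function `A(x) = 6x(1+x) / ((1+x)³ - 3(5x-1))`. -/
def funA (x : ℝ) : ℝ := 6 * x * (1 + x) / ((1 + x) ^ 3 - 3 * (5 * x - 1))

/-- The largest real root of the equation `A(x) = 1` (see `isGreatest_r₀`). -/
def r₀ : ℝ := sSup {x : ℝ | funA x = 1}

theorem setOf_funA_eq_one :
    {x : ℝ | funA x = 1} = {x : ℝ | x ^ 3 - 3 * x ^ 2 - 18 * x + 4 = 0} := by
  ext x
  simp only [Set.mem_setOf_eq, funA]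
  constructor
  · intro h
    have hd : (1 + x) ^ 3 - 3 * (5 * x - 1) ≠ 0 := by
      intro h0
      rw [h0, div_zero] at h
      exact zero_ne_one h
    rw [div_eq_one_iff_eq hd] at h
    linarith
  · intro h
    have hd : (1 + x) ^ 3 - 3 * (5 * x - 1) ≠ 0 := by
      intro h0
      have h1 : x * (1 + x) = 0 := by linarith
      rcases mul_eq_zero.mp h1 with h2 | h2
      · subst h2; norm_num at h
      · have h3 : x = -1 := by linarith
        subst h3; norm_num at h
    rw [div_eq_one_iff_eq hd]
    linarith

theorem isGreatest_r₀ : IsGreatest {x : ℝ | funA x = 1} r₀ := by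
  unfold r₀
  rw [setOf_funA_eq_one]
  have hne : {x : ℝ | x ^ 3 - 3 * x ^ 2 - 18 * x + 4 = 0}.Nonempty := by
    have h := intermediate_value_Icc (a := (5 : ℝ)) (b := 6) (by norm_num)
      (f := fun x : ℝ => x ^ 3 - 3 * x ^ 2 - 18 * x + 4) (by fun_prop)
    obtain ⟨x, -, hx⟩ := h (show (0 : ℝ) ∈ _ by constructor <;> norm_num)
    exact ⟨x, hx⟩
  have hbdd : BddAbove {x : ℝ | x ^ 3 - 3 * x ^ 2 - 18 * x + 4 = 0} := by
    refine ⟨6, fun x hx => ?_⟩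
    simp only [Set.mem_setOf_eq] at hx
    by_contra! h
    nlinarith [mul_pos (show 0 < x by linarith) (show 0 < x - 6 by linarith),
      mul_pos (mul_pos (show 0 < x by linarith) (show 0 < x - 6 by linarith))
        (show 0 < x + 3 by linarith)]
  have hcl : IsClosed {x : ℝ | x ^ 3 - 3 * x ^ 2 - 18 * x + 4 = 0} :=
    isClosed_eq (by fun_prop) continuous_const
  exact ⟨hcl.csSup_mem hne hbdd, fun x hx => le_csSup hbdd hx⟩

end Resolvent

end

open Metric Set Filter Topology
open scoped ComplexConjugate

namespace Resolvent

/-! ### Schwarz-type estimates for functions with positive real part -/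

section PositiveRealPart

variable {f : ℂ → ℂ} {c z : ℂ} {R : ℝ}

/-! Put `x = r * q.re` and write `F w = w * P w`, where `Re P > 1` and `Re P(0) = 1 + x`. With `w =
G z`, differentiating `F (G z) = z` gives `z G'(z) / G(z) = 1 / (1 + u)` for `u = w P'(w) / P(w)`,
so all three claims describe the image of the disk `‖u‖ < A` under `u ↦ 1 / (1 + u)`.

The bound on `u` uses `‖w P(w)‖ < 1`. Schwarz's lemma for `P - 1` gives `‖u‖ ≤ 2‖w‖`
(`norm_mul_deriv_div_le`), and Harnack's inequality gives `‖w‖ < 1 / (x - 1)`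
(`norm_lt_of_norm_mul_lt_one`). Since `x > r₀ ≥ 5`, the resulting `2 / (x - 1)` is at most `A`.

Injectivity of `G` is immediate from the right inverse; holomorphy requires `F` to be injective
where `‖F‖ < 1` (`eq_of_mul_eq_mul_of_one_lt_re`). -/

theorem add_conj_ne_zero_of_re_pos {a b : ℂ} (ha : 0 < a.re) (hb : 0 < b.re) :
    a + conj b ≠ 0 := by
  intro h
  have := congrArg Complex.re h
  simp at this
  linarith

theorem norm_sub_le_norm_add_conj {a b : ℂ} (ha : 0 < a.re) (hb : 0 < b.re) :
    ‖a - b‖ ≤ ‖a + conj b‖ := by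
  rw [← sq_le_sq₀ (norm_nonneg _) (norm_nonneg _)]
  simp only [Complex.sq_norm, Complex.normSq_apply, Complex.sub_re, Complex.sub_im,
    Complex.add_re, Complex.add_im, Complex.conj_re, Complex.conj_im]
  nlinarith [mul_pos ha hb]

/-- The Cayley transform of a function with positive real part, normalized at `c`. -/
noncomputable def cayley (f : ℂ → ℂ) (c z : ℂ) : ℂ := (f z - f c) / (f z + conj (f c))

theorem cayley_self : cayley f c c = 0 := by simp [cayley]

theorem differentiableOn_cayley (hR : 0 < R) (hf : DifferentiableOn ℂ f (ball c R))
    (hpos : ∀ z ∈ ball c R, 0 < (f z).re) : DifferentiableOn ℂ (cayley f c) (ball c R) :=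
  (hf.sub_const _).div (hf.add_const _) fun z hz =>
    add_conj_ne_zero_of_re_pos (hpos z hz) (hpos c (mem_ball_self hR))

theorem mapsTo_cayley (hR : 0 < R) (hpos : ∀ z ∈ ball c R, 0 < (f z).re) :
    MapsTo (cayley f c) (ball c R) (closedBall (cayley f c c) 1) := by
  intro z hz
  rw [cayley_self, mem_closedBall_zero_iff, cayley, norm_div]
  exact div_le_one_of_le₀
    (norm_sub_le_norm_add_conj (hpos z hz) (hpos c (mem_ball_self hR))) (norm_nonneg _)

/-- The lower **Harnack inequality** for the real part of a holomorphic function. -/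
theorem re_mul_one_sub_le (hf : DifferentiableOn ℂ f (ball c R))
    (hpos : ∀ z ∈ ball c R, 0 < (f z).re) (hz : z ∈ ball c R) :
    (f c).re * (1 - dist z c / R) ≤ (f z).re * (1 + dist z c / R) := by
  have hR : 0 < R := nonempty_ball.mp ⟨z, hz⟩
  have hc := hpos c (mem_ball_self hR)
  have h := Complex.dist_le_div_mul_dist_of_mapsTo_ball (differentiableOn_cayley hR hf hpos)
    (mapsTo_cayley hR hpos) hz
  rw [cayley_self, dist_zero_right, cayley, norm_div,
    div_le_iff₀ (norm_pos_iff.mpr (add_conj_ne_zero_of_re_pos (hpos z hz) hc)), one_div_mul_eq_div]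
    at h
  have ht0 : 0 ≤ dist z c / R := by positivity
  have ht1 : dist z c / R ≤ 1 := div_le_one_of_le₀ (mem_ball.mp hz).le hR.le
  generalize dist z c / R = t at *
  have hs := hpos z hz
  have h2 : ‖f z - f c‖ ^ 2 ≤ t ^ 2 * ‖f z + conj (f c)‖ ^ 2 := by
    rw [← mul_pow]; gcongr
  simp only [Complex.sq_norm, Complex.normSq_apply, Complex.sub_re, Complex.sub_im,
    Complex.add_re, Complex.add_im, Complex.conj_re, Complex.conj_im] at h2
  have h3 : ((f c).re - (f z).re) ^ 2 ≤ (t * ((f z).re + (f c).re)) ^ 2 := by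
    nlinarith [mul_nonneg (sq_nonneg ((f z).im - (f c).im))
      (show 0 ≤ 1 - t ^ 2 by nlinarith)]
  have h4 := abs_le_of_sq_le_sq' h3 (by positivity)
  linarith [h4.2]

theorem norm_deriv_le_two_mul_re_div (hR : 0 < R) (hf : DifferentiableOn ℂ f (ball c R))
    (hpos : ∀ z ∈ ball c R, 0 < (f z).re) : ‖deriv f c‖ ≤ 2 * (f c).re / R := by
  have hc := hpos c (mem_ball_self hR)
  have hd : HasDerivAt f (deriv f c) c :=
    (hf.differentiableAt (ball_mem_nhds c hR)).hasDerivAt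
  have hne := add_conj_ne_zero_of_re_pos hc hc
  have hD : deriv (cayley f c) c = deriv f c / (f c + conj (f c)) := by
    refine ((hd.sub_const _).div (hd.add_const _) hne).deriv.trans ?_
    field_simp
    ring
  have h := Complex.norm_deriv_le_div_of_mapsTo_ball (differentiableOn_cayley hR hf hpos)
    (mapsTo_cayley hR hpos) hR
  have hn : ‖f c + conj (f c)‖ = 2 * (f c).re := by
    rw [Complex.add_conj, Complex.norm_real, Real.norm_of_nonneg (by positivity)]
  rw [hD, norm_div, hn, div_le_iff₀ (by positivity)] at h
  rwa [one_div_mul_eq_div] at h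

end PositiveRealPart

/-! ### The image of a disk under `u ↦ 1 / (1 + u)` -/

/-- The disk of values `(1 + u)⁻¹` with `‖u‖ < A`. -/
theorem norm_one_sub_sq_mul_inv_sub_one_lt {A : ℝ} {u : ℂ} (hA : A < 1) (hu : ‖u‖ < A) :
    ‖((1 - A ^ 2 : ℝ) : ℂ) * (1 + u)⁻¹ - 1‖ < A := by
  have hA0 : 0 < A := (norm_nonneg u).trans_lt hu
  have hne : 1 + u ≠ 0 := by
    intro h
    have : u = -1 := by linear_combination h
    rw [this, norm_neg, norm_one] at hu
    linarith
  have h1 : ((1 - A ^ 2 : ℝ) : ℂ) * (1 + u)⁻¹ - 1 = -(((A ^ 2 : ℝ) : ℂ) + u) / (1 + u) := by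
    field_simp
    push_cast
    ring
  rw [h1, norm_div, norm_neg, div_lt_iff₀ (norm_pos_iff.mpr hne),
    ← sq_lt_sq₀ (norm_nonneg _) (by positivity), mul_pow]
  have hu2 : ‖u‖ ^ 2 < A ^ 2 := by gcongr
  simp only [Complex.sq_norm, Complex.normSq_apply, Complex.add_re, Complex.add_im,
    Complex.one_re, Complex.one_im, Complex.ofReal_re, Complex.ofReal_im] at hu2 ⊢
  nlinarith [mul_pos (sub_pos.mpr hu2) (show 0 < 1 - A ^ 2 by nlinarith)]

theorem lt_re_exp_mul_inv_one_add {A : ℝ} {u : ℂ} (hA : A < 1) (hu : ‖u‖ < A) (θ : ℝ) :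
    (Real.cos θ - A) / (1 - A ^ 2) < (Complex.exp (-(Complex.I * (θ : ℂ))) * (1 + u)⁻¹).re := by
  have hA0 : 0 < A := (norm_nonneg u).trans_lt hu
  have hD : 0 < 1 - A ^ 2 := by nlinarith
  rw [div_lt_iff₀ hD]
  have hE : Complex.exp (-(Complex.I * (θ : ℂ))) = Complex.exp ((-θ : ℝ) * Complex.I) := by
    push_cast; ring_nf
  rw [hE]
  set e := Complex.exp ((-θ : ℝ) * Complex.I) with he
  have h1 : ‖e * (((1 - A ^ 2 : ℝ) : ℂ) * (1 + u)⁻¹ - 1)‖ < A := by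
    rw [norm_mul, he, Complex.norm_exp_ofReal_mul_I, one_mul]
    exact norm_one_sub_sq_mul_inv_sub_one_lt hA hu
  have h2 := (abs_le.mp (Complex.abs_re_le_norm
    (e * (((1 - A ^ 2 : ℝ) : ℂ) * (1 + u)⁻¹ - 1)))).1
  have h3 : e * (((1 - A ^ 2 : ℝ) : ℂ) * (1 + u)⁻¹ - 1) =
      ((1 - A ^ 2 : ℝ) : ℂ) * (e * (1 + u)⁻¹) - e := by ring
  have h4 : e.re = Real.cos θ := by
    rw [he, Complex.exp_ofReal_mul_I_re, Real.cos_neg]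
  rw [h3] at h1 h2
  rw [Complex.sub_re, Complex.re_ofReal_mul, h4] at h2
  linarith

theorem abs_arg_inv_one_add_lt {A : ℝ} {u : ℂ} (hA : A < 1) (hu : ‖u‖ < A) :
    |Complex.arg (1 + u)⁻¹| < Real.arcsin A := by
  have hA0 : 0 < A := (norm_nonneg u).trans_lt hu
  have hre : 0 < (1 + u).re := by
    have := (abs_le.mp (Complex.abs_re_le_norm u)).1
    simp only [Complex.add_re, Complex.one_re]
    linarith
  have hn : 0 < ‖1 + u‖ := hre.trans_le (Complex.re_le_norm _)
  have hu2 : ‖u‖ ^ 2 < A ^ 2 := by gcongr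
  have h1 : |(1 + u).im / ‖1 + u‖| < A := by
    rw [abs_div, abs_norm, div_lt_iff₀ hn, ← sq_lt_sq₀ (abs_nonneg _) (by positivity), mul_pow,
      sq_abs]
    simp only [Complex.sq_norm, Complex.normSq_apply, Complex.add_re, Complex.add_im,
      Complex.one_re, Complex.one_im] at hu2 ⊢
    -- The slack is a perfect square: `A²(1 + a)² - (1 - A²)(A² - a²) = (A² + a)²` with `a = Re u`.
    nlinarith [mul_pos (sub_pos.mpr hu2) (show 0 < 1 - A ^ 2 by nlinarith),
      sq_nonneg (A ^ 2 + u.re)]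
  rw [Complex.abs_arg_inv, Complex.arg_of_re_nonneg hre.le]
  obtain ⟨h2, h3⟩ := abs_lt.mp h1
  rw [abs_lt, ← Real.arcsin_neg]
  exact ⟨Real.arcsin_lt_arcsin (by linarith) h2 (by linarith),
    Real.arcsin_lt_arcsin (by linarith) h3 hA.le⟩

/-! ### Numerical bounds for `r₀` and `A(x)` -/

theorem five_le_r₀ : 5 ≤ r₀ := by
  obtain ⟨x, hx, hx0⟩ := intermediate_value_Icc (a := (5 : ℝ)) (b := 6) (by norm_num)
    (f := fun x : ℝ => x ^ 3 - 3 * x ^ 2 - 18 * x + 4) (by fun_prop)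
    (show (0 : ℝ) ∈ _ by constructor <;> norm_num)
  refine hx.1.trans (isGreatest_r₀.2 ?_)
  rw [setOf_funA_eq_one]
  exact hx0

theorem cubic_pos_of_r₀_lt {x : ℝ} (hx : r₀ < x) : 0 < x ^ 3 - 3 * x ^ 2 - 18 * x + 4 := by
  have h5 := five_le_r₀
  have h0 : r₀ ^ 3 - 3 * r₀ ^ 2 - 18 * r₀ + 4 = 0 := by
    have := isGreatest_r₀.1
    rwa [setOf_funA_eq_one] at this
  -- The second factor is the cubic's difference quotient, positive because `x` and `r₀` are at
  -- least 5.
  have : 0 < (x - r₀) * (x ^ 2 + x * r₀ + r₀ ^ 2 - 3 * (x + r₀) - 18) :=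
    mul_pos (by linarith) (by nlinarith)
  nlinarith

theorem funA_denom_pos {x : ℝ} (hx : 5 ≤ x) : 0 < (1 + x) ^ 3 - 3 * (5 * x - 1) := by
  nlinarith [mul_nonneg (sub_nonneg.mpr hx) (sq_nonneg x), sq_nonneg x]

theorem funA_lt_one {x : ℝ} (hx : r₀ < x) : funA x < 1 := by
  have h5 := five_le_r₀
  rw [funA, div_lt_one (funA_denom_pos (by linarith))]
  linarith [cubic_pos_of_r₀_lt hx]

theorem two_div_sub_one_le_funA {x : ℝ} (hx : 5 ≤ x) : 2 / (x - 1) ≤ funA x := by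
  rw [funA, div_le_div_iff₀ (by linarith) (funA_denom_pos hx)]
  nlinarith [mul_nonneg (sub_nonneg.mpr hx) (sq_nonneg x), sq_nonneg x]

theorem funA_pos {x : ℝ} (hx : 5 ≤ x) : 0 < funA x :=
  (div_pos two_pos (by linarith)).trans_le (two_div_sub_one_le_funA hx)

theorem funA_lt_six_div {x : ℝ} (hx : 6 ≤ x) : funA x < 6 / x := by
  rw [funA, div_lt_div_iff₀ (funA_denom_pos (by linarith)) (by linarith)]
  nlinarith

/-- For `x ≥ 6` the bound `6 / x` separates the two sides; for `x ≤ 6` the `arccos` vanishes,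
leaving only `θ = 0`. -/
theorem funA_lt_cos {x θ : ℝ} (hx : r₀ < x) (hθ : |θ| ≤ Real.arccos (6 / x)) :
    funA x < Real.cos θ := by
  have h5 := five_le_r₀
  rcases le_total 6 x with h6 | h6
  · refine (funA_lt_six_div h6).trans_le ?_
    have h1 : 6 / x ≤ 1 := div_le_one_of_le₀ h6 (by linarith)
    have h0 : 0 ≤ 6 / x := by positivity
    rw [← Real.cos_abs θ, ← Real.cos_arccos (by linarith) h1]
    exact Real.cos_le_cos_of_nonneg_of_le_pi (abs_nonneg _) (Real.arccos_le_pi _) hθ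
  · rw [Real.arccos_of_one_le ((one_le_div (by linarith)).mpr h6)] at hθ
    rw [abs_nonpos_iff.mp hθ, Real.cos_zero]
    exact funA_lt_one hx

/-! ### Estimates for `P` and injectivity of `w * P w` -/

section Quotient

variable {P : ℂ → ℂ} {x : ℝ} {w a b : ℂ}

theorem norm_lt_of_norm_mul_lt_one (hP : DifferentiableOn ℂ P disk)
    (hre : ∀ z ∈ disk, 1 < (P z).re) (h0 : (P 0).re = 1 + x) (hx : 1 < x) (hw : w ∈ disk)
    (hwP : ‖w * P w‖ < 1) : ‖w‖ < 1 / (x - 1) := by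
  have h := re_mul_one_sub_le (f := fun z => P z - 1) (hP.sub_const 1)
    (fun z hz => by simpa using hre z hz) hw
  simp only [Complex.sub_re, Complex.one_re, h0, dist_zero_right, div_one] at h
  have ht : ‖w‖ < 1 := by simpa [disk] using hw
  have h2 : ‖w‖ * (P w).re < 1 := by
    rw [norm_mul] at hwP
    exact (mul_le_mul_of_nonneg_left (Complex.re_le_norm _) (norm_nonneg _)).trans_lt hwP
  have hn := norm_nonneg w
  rw [lt_div_iff₀ (by linarith)]
  have h3 := mul_le_mul_of_nonneg_left h hn
  -- Harnack times `‖w‖`, combined with `‖w‖ Re P(w) < 1`; the common factor `1 - ‖w‖` then cancels.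
  have h4 : 0 < (1 - ‖w‖) * (1 - ‖w‖ * (x - 1)) := by nlinarith
  linarith [pos_of_mul_pos_right h4 (by linarith)]

theorem norm_deriv_le_of_one_lt_re (hP : DifferentiableOn ℂ P disk)
    (hre : ∀ z ∈ disk, 1 < (P z).re) (hw : w ∈ disk) :
    ‖deriv P w‖ ≤ 2 * ((P w).re - 1) / (1 - ‖w‖) := by
  have ht : ‖w‖ < 1 := by simpa [disk] using hw
  have hsub : ball w (1 - ‖w‖) ⊆ disk := ball_subset_ball' (by simp)
  have h := norm_deriv_le_two_mul_re_div (f := fun z => P z - 1) (c := w) (R := 1 - ‖w‖)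
    (by linarith) ((hP.sub_const 1).mono hsub) (fun z hz => by simpa using hre z (hsub hz))
  simpa [deriv_sub_const] using h

theorem norm_mul_deriv_div_le (hP : DifferentiableOn ℂ P disk)
    (hre : ∀ z ∈ disk, 1 < (P z).re) (hw : w ∈ disk) (hwP : ‖w * P w‖ < 1) :
    ‖w * deriv P w / P w‖ ≤ 2 * ‖w‖ := by
  have ht : ‖w‖ < 1 := by simpa [disk] using hw
  have hPn : (P w).re ≤ ‖P w‖ := Complex.re_le_norm _
  have h1 := hre w hw
  rw [norm_mul] at hwP
  rw [norm_div, norm_mul, div_le_iff₀ (by linarith)]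
  have h2 : ‖deriv P w‖ ≤ 2 * ‖P w‖ := by
    refine (norm_deriv_le_of_one_lt_re hP hre hw).trans ?_
    rw [div_le_iff₀ (by linarith)]
    -- Here `‖w‖‖P w‖ < 1` gives `Re P - 1 ≤ ‖P‖ - 1 ≤ ‖P‖(1 - ‖w‖)`.
    nlinarith
  nlinarith [mul_le_mul_of_nonneg_left h2 (norm_nonneg w)]

theorem norm_deriv_inv_le (hP : DifferentiableOn ℂ P disk)
    (hre : ∀ z ∈ disk, 1 < (P z).re) (hw : w ∈ ball (0 : ℂ) (1 / 4)) :
    ‖deriv (fun z => (P z)⁻¹) w‖ ≤ 2 / 3 := by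
  have ht : ‖w‖ < 1 / 4 := by simpa using hw
  have hwd : w ∈ disk := ball_subset_ball (by norm_num) hw
  have h1 := hre w hwd
  have hPn : (P w).re ≤ ‖P w‖ := Complex.re_le_norm _
  have hne : P w ≠ 0 := norm_pos_iff.mp (by linarith)
  have hd : DifferentiableAt ℂ P w := hP.differentiableAt (isOpen_ball.mem_nhds hwd)
  rw [hd.hasDerivAt.fun_inv hne |>.deriv, norm_div, norm_neg, norm_pow,
    div_le_iff₀ (by nlinarith)]
  refine (norm_deriv_le_of_one_lt_re hP hre hwd).trans ?_
  rw [div_le_iff₀ (by linarith)]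
  -- With `p = ‖P w‖`, `(p - 1) / p² ≤ 1/4` and `1 - ‖w‖ ≥ 3/4`, whence the constant `2/3`.
  nlinarith [sq_nonneg (‖P w‖ - 2),
    mul_nonneg (sq_nonneg ‖P w‖) (show 0 ≤ 1 / 4 - ‖w‖ by linarith)]

/-- A contraction argument: both points are fixed by `w ↦ ζ / P(w)` with `ζ = a P(a)`, `‖ζ‖ < 1`,
and `1 / P` is `2/3`-Lipschitz on the disk of radius `1/4`, which contains both points because `x ≥
5`. -/
theorem eq_of_mul_eq_mul_of_one_lt_re (hP : DifferentiableOn ℂ P disk)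
    (hre : ∀ z ∈ disk, 1 < (P z).re) (h0 : (P 0).re = 1 + x) (hx : 5 ≤ x) (ha : a ∈ disk)
    (hb : b ∈ disk) (haP : ‖a * P a‖ < 1) (hab : a * P a = b * P b) : a = b := by
  have hsmall : ∀ w ∈ disk, ‖w * P w‖ < 1 → w ∈ ball (0 : ℂ) (1 / 4) := by
    intro w hw hwP
    rw [mem_ball_zero_iff]
    refine (norm_lt_of_norm_mul_lt_one hP hre h0 (by linarith) hw hwP).trans_le ?_
    exact one_div_le_one_div_of_le (by norm_num) (by linarith)
  have hne : ∀ w ∈ disk, P w ≠ 0 := fun w hw =>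
    norm_pos_iff.mp (by linarith [hre w hw, Complex.re_le_norm (P w)])
  have hlip := Convex.norm_image_sub_le_of_norm_deriv_le (𝕜 := ℂ) (f := fun z => (P z)⁻¹)
    (s := ball (0 : ℂ) (1 / 4)) (C := 2 / 3)
    (fun w hw => by
      have hwd : w ∈ disk := ball_subset_ball (by norm_num) hw
      exact (hP.differentiableAt (isOpen_ball.mem_nhds hwd)).inv (hne w hwd))
    (fun w hw => norm_deriv_inv_le hP hre hw) (convex_ball _ _)
    (hsmall b hb (hab ▸ haP)) (hsmall a ha haP)
  have hA := hne a ha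
  have hB := hne b hb
  have heq : a - b = a * P a * ((P a)⁻¹ - (P b)⁻¹) := by
    rw [mul_sub, mul_inv_cancel_right₀ hA, hab, mul_inv_cancel_right₀ hB]
  have hnorm : ‖a - b‖ ≤ 2 / 3 * ‖a - b‖ := by
    calc ‖a - b‖ = ‖a * P a‖ * ‖(P a)⁻¹ - (P b)⁻¹‖ := by rw [← norm_mul, ← heq]
      _ ≤ 1 * ‖(P a)⁻¹ - (P b)⁻¹‖ := by gcongr
      _ ≤ 2 / 3 * ‖a - b‖ := by rw [one_mul]; exact hlip
  exact sub_eq_zero.mp (norm_le_zero_iff.mp (by linarith [norm_nonneg (a - b)]))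

end Quotient

/-! ### Differentiability and star quotient of the right inverse -/

section Inverse

variable {P G : ℂ → ℂ} {x : ℝ} {z : ℂ}

theorem norm_mul_deriv_div_lt_funA (hP : DifferentiableOn ℂ P disk)
    (hre : ∀ z ∈ disk, 1 < (P z).re) (h0 : (P 0).re = 1 + x) (hx : 5 ≤ x) {w : ℂ}
    (hw : w ∈ disk) (hwP : ‖w * P w‖ < 1) : ‖w * deriv P w / P w‖ < funA x := by
  have h1 := norm_mul_deriv_div_le hP hre hw hwP
  have h2 := norm_lt_of_norm_mul_lt_one hP hre h0 (by linarith) hw hwP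
  have h3 := two_div_sub_one_le_funA hx
  have h4 : 2 / (x - 1) = 2 * (1 / (x - 1)) := by ring
  linarith

/-- Continuity of `G` is not assumed. Injectivity of `w * P w` where its modulus is below 1 makes
`G` a local left inverse near `G z`, so the inverse function theorem applies; the derivative is
nonzero since `‖u‖ < A < 1`. -/
theorem hasDerivAt_of_rightInverse (hP : DifferentiableOn ℂ P disk)
    (hre : ∀ z ∈ disk, 1 < (P z).re) (h0 : (P 0).re = 1 + x) (hx : r₀ < x)
    (hG : MapsTo G disk disk) (hPG : ∀ z ∈ disk, G z * P (G z) = z) (hz : z ∈ disk) :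
    HasDerivAt G (P (G z) * (1 + G z * deriv P (G z) / P (G z)))⁻¹ z := by
  have h5 : 5 ≤ x := five_le_r₀.trans hx.le
  have hdisk : IsOpen disk := isOpen_ball
  have hw := hG hz
  have hwn := hdisk.mem_nhds hw
  have hnorm : ∀ z ∈ disk, ‖G z * P (G z)‖ < 1 := fun z hz => by
    rw [hPG z hz]; simpa [disk] using hz
  have hPw : P (G z) ≠ 0 :=
    norm_pos_iff.mp (by linarith [hre _ hw, Complex.re_le_norm (P (G z))])
  have hu := norm_mul_deriv_div_lt_funA hP hre h0 h5 hw (hnorm z hz)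
  have hu1 : 1 + G z * deriv P (G z) / P (G z) ≠ 0 := by
    intro h
    have h' : G z * deriv P (G z) / P (G z) = -1 := by linear_combination h
    rw [h', norm_neg, norm_one] at hu
    linarith [funA_lt_one hx]
  have hF : DifferentiableOn ℂ (fun w => w * P w) disk := differentiableOn_id.mul hP
  have hd : HasDerivAt (fun w => w * P w)
      (P (G z) * (1 + G z * deriv P (G z) / P (G z))) (G z) := by
    refine ((hasDerivAt_id (G z)).mul (hP.differentiableAt hwn).hasDerivAt).congr_deriv ?_
    simp only [id]
    field_simp
  have hs : HasStrictDerivAt (fun w => w * P w)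
      (P (G z) * (1 + G z * deriv P (G z) / P (G z))) (G z) := by
    have := (hF.analyticAt hwn).hasStrictDerivAt
    rwa [hd.deriv] at this
  have hleft : ∀ᶠ w in 𝓝 (G z), G (w * P w) = w := by
    have hmem : disk ∈ 𝓝 (G z * P (G z)) := by
      rw [hPG z hz]; exact hdisk.mem_nhds hz
    filter_upwards [hwn, hd.continuousAt.eventually hmem] with w hw1 hw2
    exact eq_of_mul_eq_mul_of_one_lt_re hP hre h0 h5 (hG hw2) hw1 (hnorm _ hw2) (hPG _ hw2)
  have := (hs.to_local_left_inverse (mul_ne_zero hPw hu1) hleft).hasDerivAt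
  rwa [hPG z hz] at this

theorem starQuotient_eq_inv_one_add (hP : DifferentiableOn ℂ P disk)
    (hre : ∀ z ∈ disk, 1 < (P z).re) (h0 : (P 0).re = 1 + x) (hx : r₀ < x)
    (hG : MapsTo G disk disk) (hPG : ∀ z ∈ disk, G z * P (G z) = z) (hz : z ∈ disk) :
    starQuotient G z = (1 + G z * deriv P (G z) / P (G z))⁻¹ := by
  have hPw : P (G z) ≠ 0 :=
    norm_pos_iff.mp (by linarith [hre _ (hG hz), Complex.re_le_norm (P (G z))])
  have hz' := hPG z hz
  by_cases h : z = 0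
  · have : G z = 0 := (mul_eq_zero.mp (hz'.trans h)).resolve_right hPw
    rw [this, h, starQuotient, if_pos rfl]
    simp
  · have hGz : G z ≠ 0 := fun h' => h (by rw [← hz', h', zero_mul])
    rw [starQuotient, if_neg h, (hasDerivAt_of_rightInverse hP hre h0 hx hG hPG hz).deriv, mul_inv]
    nth_rewrite 1 [← hz']
    field_simp

theorem isUnivalentZero_of_rightInverse (hP : DifferentiableOn ℂ P disk)
    (hre : ∀ z ∈ disk, 1 < (P z).re) (h0 : (P 0).re = 1 + x) (hx : r₀ < x)
    (hG : MapsTo G disk disk) (hPG : ∀ z ∈ disk, G z * P (G z) = z) : IsUnivalentZero G where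
  holo _ hz :=
    (hasDerivAt_of_rightInverse hP hre h0 hx hG hPG hz).differentiableAt.differentiableWithinAt
  inj a ha b hb hab := by rw [← hPG a ha, ← hPG b hb, hab]
  map_zero := by
    have h : (0 : ℂ) ∈ disk := mem_ball_self one_pos
    exact (mul_eq_zero.mp (hPG 0 h)).resolve_right
      (norm_pos_iff.mp (by linarith [hre _ (hG h), Complex.re_le_norm (P (G 0))]))

end Inverse

/-- The members of `classA (2x) β` with `Re β = 1 + x` are the products `w * P w` with
`Re P > 1`. -/
theorem exists_eq_mul_of_mem_classA {F : ℂ → ℂ} {β : ℂ} {x : ℝ} (hx : 0 < x)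
    (hβ : β.re = 1 + x) (hF : F ∈ classA ((2 * x : ℝ) : ℂ) β) :
    ∃ P : ℂ → ℂ, DifferentiableOn ℂ P disk ∧ (∀ z ∈ disk, 1 < (P z).re) ∧
      (P 0).re = 1 + x ∧ ∀ w, F w = w * P w := by
  obtain ⟨hd, hF0, hF1, hre⟩ := hF
  have h0 : (0 : ℂ) ∈ disk := mem_ball_self one_pos
  have hP0 : dslope F 0 0 = β := by rw [dslope_same, hF1]
  refine ⟨dslope F 0, (Complex.differentiableOn_dslope (isOpen_ball.mem_nhds h0)).mpr hd,
    fun z hz => ?_, by rw [hP0, hβ], fun w => ?_⟩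
  · by_cases h : z = 0
    · rw [h, hP0, hβ]; linarith
    · have h1 := hre z hz h
      rw [dslope_of_ne _ h, slope_def_field, hF0, sub_zero, sub_zero]
      rw [one_div (((2 * x : ℝ) : ℂ)), ← Complex.ofReal_inv, Complex.re_ofReal_mul, Complex.sub_re, hβ,
        inv_mul_eq_div, lt_div_iff₀ (by positivity)] at h1
      linarith
  · have := sub_smul_dslope F 0 w
    rw [sub_zero, hF0, sub_zero, smul_eq_mul] at this
    exact this.symm

end Resolvent

/-! ### The three geometric conclusions -/

theorem mainTheorem3 (q : ℂ) (hq : 0 < q.re) (r : ℝ) (hr : Resolvent.r₀ < r * q.re)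
    (G : ℂ → ℂ) (hG : G ∈ Resolvent.resolvents r q) :
    (∀ θ : ℝ, |θ| ≤ Real.arccos (6 / (r * q.re)) →
      Resolvent.IsSpirallikeOfOrder θ
        ((Real.cos θ - Resolvent.funA (r * q.re)) /
          ((1 - Resolvent.funA (r * q.re) ^ 2) * Real.cos θ)) G) ∧
    Resolvent.IsStarlikeOfOrder (1 / (1 + Resolvent.funA (r * q.re))) G ∧
    Resolvent.IsStronglyStarlikeOfOrder
      (2 / Real.pi * Real.arcsin (Resolvent.funA (r * q.re))) G := by
  open Resolvent in
  obtain ⟨F, hF, hmaps, hFG⟩ := hG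
  have h5 : 5 ≤ r * q.re := five_le_r₀.trans hr.le
  obtain ⟨P, hP, hre, h0, hFP⟩ := exists_eq_mul_of_mem_classA (x := r * q.re) (by linarith)
    (β := 1 + r * q) (by simp) (by rwa [← mul_assoc])
  have hPG : ∀ z ∈ disk, G z * P (G z) = z := fun z hz => by rw [← hFP, hFG z hz]
  have huni := isUnivalentZero_of_rightInverse hP hre h0 hr hmaps hPG
  have hA0 := funA_pos h5
  have hA1 := funA_lt_one hr
  have hstar : ∀ z ∈ disk, ∃ u : ℂ, ‖u‖ < funA (r * q.re) ∧ starQuotient G z = (1 + u)⁻¹ :=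
    fun z hz => ⟨_, norm_mul_deriv_div_lt_funA hP hre h0 h5 (hmaps hz)
      (by rw [hPG z hz]; simpa [disk] using hz),
      starQuotient_eq_inv_one_add hP hre h0 hr hmaps hPG hz⟩
  have hcos := fun θ => funA_lt_cos (θ := θ) hr
  generalize funA (r * q.re) = A at *
  have hD : 0 < 1 - A ^ 2 := by nlinarith
  refine ⟨fun θ hθ => ⟨huni, ⟨?_, ?_⟩, fun z hz => ?_⟩, ⟨huni, ⟨by positivity, ?_⟩, fun z hz => ?_⟩,
    ⟨huni, ⟨?_, ?_⟩, fun z hz => ?_⟩⟩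
  · have hc := hcos θ hθ
    exact div_pos (by linarith) (mul_pos hD (by linarith))
  · have hc := hcos θ hθ
    rw [div_lt_one (mul_pos hD (by linarith))]
    nlinarith [Real.cos_le_one θ]
  · have hc := hcos θ hθ
    obtain ⟨u, hu, hs⟩ := hstar z hz
    rw [hs, ← div_div, div_mul_cancel₀ _ (by linarith)]
    exact lt_re_exp_mul_inv_one_add hA1 hu θ
  · rw [div_lt_one (by linarith)]
    linarith
  · obtain ⟨u, hu, hs⟩ := hstar z hz
    -- Starlikeness is the case `θ = 0` of the spirallike estimate.
    have h := lt_re_exp_mul_inv_one_add hA1 hu 0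
    rw [hs]
    have hA : 1 / (1 + A) = (1 - A) / (1 - A ^ 2) := by
      rw [div_eq_div_iff (by linarith) hD.ne']
      ring
    simpa [hA] using h
  · have := Real.arcsin_pos.mpr hA0
    have := Real.pi_pos
    positivity
  · have := Real.arcsin_lt_pi_div_two.mpr hA1
    rw [div_mul_eq_mul_div, div_lt_one Real.pi_pos]
    linarith
  · obtain ⟨u, hu, hs⟩ := hstar z hz
    have hπ : Real.pi * (2 / Real.pi * Real.arcsin A) / 2 = Real.arcsin A := by
      field_simp
    rw [hs, hπ]
    exact abs_arg_inv_one_add_lt hA1 hu
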